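/- All graphs are finite, simple and undirected. A \emph{convex drawing} of a graph $G$ represents the vertices of $G$ by distinct points on a circle in the plane and each edge by the straight line-segment between its endpoints, such that no three edges meet in a point other than a common endpoint. Two distinct edges \emph{cross} if they have a common point that is not a common endpoint. A \emph{strong tree decomposition} of $G$ consists of a finite tree $T$ and a set $B_i\subseteq V(G)$ (a \emph{bag}) for each node $i$ of $T$, such that for every vertex $v$ of $G$ the nodes $i$ with $v\in B_i$ induce a nonempty connected subgraph of $T$, and for every edge $vw$ of $G$ some bag contains both $v$ and $w$; its \emph{width} is $\max_i|B_i|$. The \emph{tree-width} of $G$ is $1$ less than the minimum width of a strong tree decomposition of $G$. Let $k\geq 0$ be an integer. Suppose that a graph $G$ has a convex drawing such that whenever two edges $e$ and $f$ cross, $e$ crosses at most $k$ edges or $f$ crosses at most $k$ edges. Then $G$ has tree-width at most $3k+11$. -/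

import Mathlib

/-- The Euclidean plane. -/
abbrev Plane : Type := EuclideanSpace ℝ (Fin 2)

/-- The straight line-segment joining the images of the two ends of `e`. -/
def edgeSegment {V : Type*} (pos : V → Plane) (e : Sym2 V) : Set Plane :=
  Sym2.lift ⟨fun u v => segment ℝ (pos u) (pos v), fun u v => segment_symm ℝ (pos u) (pos v)⟩ e

/-- A rectilinear drawing of `G` in the plane: distinct vertices are distinct points, each edge is
the line-segment between its ends, the only vertices an edge meets are its own ends, and no three
edges meet in a point, except at a common end. -/
structure RectilinearDrawing {V : Type*} (G : SimpleGraph V) where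
  pos : V → Plane
  injective : Function.Injective pos
  vertex_mem : ∀ e ∈ G.edgeSet, ∀ v : V, pos v ∈ edgeSegment pos e → v ∈ e
  no_three : ∀ e ∈ G.edgeSet, ∀ f ∈ G.edgeSet, ∀ g ∈ G.edgeSet, e ≠ f → f ≠ g → e ≠ g →
    ∀ x ∈ edgeSegment pos e ∩ edgeSegment pos f ∩ edgeSegment pos g,
      ∃ v : V, v ∈ e ∧ v ∈ f ∧ v ∈ g ∧ x = pos v

namespace RectilinearDrawing

variable {V : Type*} {G : SimpleGraph V}

/-- The drawing is convex: all vertices lie on a common circle. -/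
def IsConvex (Γ : RectilinearDrawing G) : Prop :=
  EuclideanGeometry.Cospherical (Set.range Γ.pos)

/-- Two distinct edges cross if they meet in a point that is not a common end of them. -/
def Crosses (Γ : RectilinearDrawing G) (e f : Sym2 V) : Prop :=
  e ∈ G.edgeSet ∧ f ∈ G.edgeSet ∧ e ≠ f ∧
    ∃ x ∈ edgeSegment Γ.pos e ∩ edgeSegment Γ.pos f, ∀ v : V, v ∈ e → v ∈ f → x ≠ Γ.pos v

/-- The set of edges that are crossed by `e`. -/
def crossedEdges (Γ : RectilinearDrawing G) (e : Sym2 V) : Set (Sym2 V) :=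
  {f | Γ.Crosses e f}

end RectilinearDrawing

/-- A decomposition of `G` indexed by the graph `D`: every node `i` of `D` carries a bag of vertices
of `G`, the nodes whose bags contain a given vertex induce a connected nonempty subgraph of `D`,
and for adjacent vertices of `G` these subgraphs share a node or are joined by an edge of `D`. -/
structure GraphDecomposition {V ι : Type*} (G : SimpleGraph V) (D : SimpleGraph ι) where
  bag : ι → Finset V
  connected : ∀ v : V, (D.induce {i | v ∈ bag i}).Connected
  touch : ∀ v w : V, G.Adj v w → ∃ i j : ι, v ∈ bag i ∧ w ∈ bag j ∧ (i = j ∨ D.Adj i j)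

namespace GraphDecomposition

variable {V ι : Type*} {G : SimpleGraph V} {D : SimpleGraph ι}

/-- A decomposition is strong if the two ends of each edge of `G` lie in a common bag. -/
def IsStrong (X : GraphDecomposition G D) : Prop :=
  ∀ v w : V, G.Adj v w → ∃ i : ι, v ∈ X.bag i ∧ w ∈ X.bag i

/-- The width of a decomposition is the maximum cardinality of a bag. -/
def width [Fintype ι] (X : GraphDecomposition G D) : ℕ :=
  Finset.univ.sup fun i => (X.bag i).card

end GraphDecomposition

/-- The widths of the strong tree decompositions of `G`. Every finite tree is isomorphic to one
whose nodes are `0, …, n - 1`. -/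
def strongTreeWidths {V : Type*} (G : SimpleGraph V) : Set ℕ :=
  {m | ∃ (n : ℕ) (T : SimpleGraph (Fin n)) (X : GraphDecomposition G T),
    T.IsTree ∧ X.IsStrong ∧ X.width = m}

/-- The tree-width of `G` is one less than the minimum width of a strong tree decomposition. It is
an integer because the graph without vertices has tree-width `-1`. -/
noncomputable def treeWidth {V : Type*} (G : SimpleGraph V) : ℤ :=
  ((sInf (strongTreeWidths G) : ℕ) : ℤ) - 1

/-- The minimum in the definition of tree-width is taken over a nonempty set. -/
theorem strongTreeWidths_nonempty {V : Type*} [Finite V] (G : SimpleGraph V) :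
    (strongTreeWidths G).Nonempty := by
  have := Fintype.ofFinite V
  refine ⟨_, 1, ⊥, ⟨fun _ => Finset.univ, fun v => ?_, fun v w _ => ?_⟩, ?_, ?_, rfl⟩
  · have : Nonempty ({i : Fin 1 | v ∈ (Finset.univ : Finset V)}) := ⟨⟨0, by simp⟩⟩
    exact ⟨fun a b => by rw [Subsingleton.elim a b]⟩
  · exact ⟨0, 0, by simp⟩
  · exact ⟨⟨fun a b => by rw [Subsingleton.elim a b]⟩, SimpleGraph.isAcyclic_bot⟩
  · exact fun v w _ => ⟨0, by simp⟩

/-! Number the vertices along the circle, so that edges with interleaving ends cross; the drawing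
enters only through `InterleavingLight`. Triangulate the polygon from its outer chord inwards so
that every chord `ab` reached is crossed by at most `2k` edges.

`exists_corner` finds the apex `c`. Order the edges crossing `ab` by their inner ends and let `p` be
the median. If at most `k` other edges within `[a, b]` pass over `p`, take `c = p`: each new side is
crossed by at most half of the `2k` edges and by those `k`. Otherwise the edges passing over `p` all
cross the median edge, which is therefore heavy, so they are light; an extremal one of them has an
end that serves as `c`.

The dual tree of the triangulation carries the decomposition (`exists_treeBags_extend`). A bag holds
the three corners and the lower end of each of the at most `2k + k` edges passing the triangle. The
lower end of an edge stays in the bags until its upper end is a corner. Bags have at most `3k + 3`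
vertices, so the tree-width is at most `3k + 2`. -/

/-! ### Counting edges across chords and choosing the apex of a triangle -/

section Combinatorics

variable {V : Type*} [LinearOrder V] [Fintype V] (G : SimpleGraph V)

open Classical in
/-- The edges of `G` that cross the chord `ab` of a convex polygon whose vertices are numbered in
cyclic order, as pairs of the end strictly between `a` and `b` and the end beyond them. -/
noncomputable def chordCrossings (a b : V) : Finset (V × V) :=
  Finset.univ.filter fun x => G.Adj x.1 x.2 ∧ a < x.1 ∧ x.1 < b ∧ (x.2 < a ∨ b < x.2)

open Classical in
/-- The edges of `G`, other than `ab`, from `[a, c)` to `(c, b]`. -/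
noncomputable def cornerEdges (a c b : V) : Finset (V × V) :=
  Finset.univ.filter fun x =>
    G.Adj x.1 x.2 ∧ a ≤ x.1 ∧ x.1 < c ∧ c < x.2 ∧ x.2 ≤ b ∧ ¬(x.1 = a ∧ x.2 = b)

variable {G}

theorem mem_chordCrossings {a b : V} {x : V × V} : x ∈ chordCrossings G a b ↔
    G.Adj x.1 x.2 ∧ a < x.1 ∧ x.1 < b ∧ (x.2 < a ∨ b < x.2) := by
  simp [chordCrossings]

theorem mem_cornerEdges {a c b : V} {x : V × V} : x ∈ cornerEdges G a c b ↔
    G.Adj x.1 x.2 ∧ a ≤ x.1 ∧ x.1 < c ∧ c < x.2 ∧ x.2 ≤ b ∧ ¬(x.1 = a ∧ x.2 = b) := by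
  simp [cornerEdges]

/-- A nonempty finite family in a linear order has a median. -/
theorem Finset.exists_median {α β : Type*} [LinearOrder β] (s : Finset α) (hs : s.Nonempty)
    (f : α → β) : ∃ x ∈ s, 2 * (s.filter fun y => f y < f x).card ≤ s.card ∧
      2 * (s.filter fun y => f x < f y).card ≤ s.card := by
  classical
  obtain ⟨m, hm, hmin⟩ := s.exists_min_image f hs
  have hne : (s.filter fun x => 2 * (s.filter fun y => f y < f x).card ≤ s.card).Nonempty := by
    refine ⟨m, Finset.mem_filter.2 ⟨hm, ?_⟩⟩
    rw [Finset.filter_false_of_mem fun y hy => not_lt.2 (hmin y hy)]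
    simp
  obtain ⟨x, hx, hmax⟩ := Finset.exists_max_image _ f hne
  rw [Finset.mem_filter] at hx
  refine ⟨x, hx.1, hx.2, ?_⟩
  by_contra! hlt
  have hpos : (s.filter fun y => f x < f y).Nonempty := by
    rw [← Finset.card_pos]; omega
  -- If more than half lay above `x`, the next larger value `f z` would still have at most half
  -- below it, against the maximality of `f x`.
  obtain ⟨z, hz, hzmin⟩ := Finset.exists_min_image _ f hpos
  rw [Finset.mem_filter] at hz
  have hsub : (s.filter fun y => f y < f z) ⊆ s.filter fun y => ¬ f x < f y := by
    intro y hy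
    rw [Finset.mem_filter] at hy ⊢
    exact ⟨hy.1, fun h => (hzmin y (Finset.mem_filter.2 ⟨hy.1, h⟩)).not_gt hy.2⟩
  have h1 := Finset.card_le_card hsub
  have h2 := Finset.card_filter_add_card_filter_not (s := s) fun y => f x < f y
  exact (hmax z (Finset.mem_filter.2 ⟨hz.1, by omega⟩)).not_gt hz.2

theorem card_cornerEdges_le {a c b : V} {s : Finset (V × V)}
    (h : ∀ x ∈ cornerEdges G a c b, x.swap ∈ s) : (cornerEdges G a c b).card ≤ s.card :=
  Finset.card_le_card_of_injOn Prod.swap h Prod.swap_injective.injOn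

/-- An edge leaving `(a, c)` across `ac` either leaves `[a, b]`, and so crosses `ab`, or ends in
`(c, b]`. -/
theorem card_chordCrossings_left_le {a c b : V} (hcb : c < b) :
    (chordCrossings G a c).card ≤
      ((chordCrossings G a b).filter fun x => x.1 < c).card + (cornerEdges G a c b).card := by
  refine (Finset.card_le_card fun x hx => ?_).trans (Finset.card_union_le _ _)
  simp only [Finset.mem_union, Finset.mem_filter, mem_chordCrossings, mem_cornerEdges] at hx ⊢
  grind

theorem card_chordCrossings_right_le {a c b : V} (hac : a < c) :
    (chordCrossings G c b).card ≤
      ((chordCrossings G a b).filter fun x => c < x.1).card + (cornerEdges G a c b).card := by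
  rw [← Finset.card_image_of_injective (cornerEdges G a c b) Prod.swap_injective]
  refine (Finset.card_le_card fun x hx => ?_).trans (Finset.card_union_le _ _)
  simp only [Finset.mem_union, Finset.mem_filter, Finset.mem_image, mem_chordCrossings,
    mem_cornerEdges] at hx ⊢
  by_cases h : x.2 < a ∨ b < x.2
  · grind
  · refine Or.inr ⟨x.swap, ?_, Prod.swap_swap x⟩
    have := hx.1.symm
    simp only [Prod.fst_swap, Prod.snd_swap]
    grind

/-- Whenever two edges interleave, one of them is crossed at most `k` times. -/
def InterleavingLight (G : SimpleGraph V) (k : ℕ) : Prop :=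
  ∀ a b c d : V, G.Adj a b → G.Adj c d → a < c → c < b → b < d →
    (chordCrossings G a b).card ≤ k ∨ (chordCrossings G c d).card ≤ k

/-- This is the choice of apex when nothing crosses `ab`, so that there is no median edge. The
farthest inner neighbour `d` of `a` works unless `ad` is heavy; then the edges over `d` are light,
and the one with the lowest start provides the apex. -/
theorem exists_card_cornerEdges_le {k : ℕ} (hG : InterleavingLight G k) {a b : V}
    (hne : ∃ v, a < v ∧ v < b) :
    ∃ c, a < c ∧ c < b ∧ (cornerEdges G a c b).card ≤ k := by
  classical
  by_cases hN : ∃ v, a < v ∧ v < b ∧ G.Adj a v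
  · obtain ⟨d, hd, hmax⟩ := Finset.exists_max_image
      (Finset.univ.filter fun v => a < v ∧ v < b ∧ G.Adj a v) id (by
        obtain ⟨v, hv⟩ := hN
        exact ⟨v, by simpa using hv⟩)
    simp only [Finset.mem_filter, Finset.mem_univ, true_and, id] at hd hmax
    by_cases hY : (cornerEdges G a d b).card ≤ k
    · exact ⟨d, hd.1, hd.2.1, hY⟩
    push Not at hY
    have hsub : cornerEdges G a d b ⊆ chordCrossings G a d := by
      intro x hx
      rw [mem_cornerEdges] at hx
      rw [mem_chordCrossings]
      have := hmax x.2
      grind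
    have hheavy := hY.trans_le (Finset.card_le_card hsub)
    obtain ⟨⟨c, q⟩, hcq, hmin⟩ := Finset.exists_min_image (cornerEdges G a d b) Prod.fst
      (Finset.card_pos.1 (by omega))
    have hcq' := mem_chordCrossings.1 (hsub hcq)
    rw [mem_cornerEdges] at hcq
    simp only at hcq hcq' hmin
    have hlight := (hG a d c q hd.2.2 hcq.1 hcq'.2.1 hcq.2.2.1 hcq.2.2.2.1).resolve_left (by omega)
    -- By minimality of `c`, an edge passing over `c` ends at or before `d < q`, so it crosses the
    -- light edge `cq`.
    refine ⟨c, hcq'.2.1, hcq.2.2.1.trans hd.2.1, (card_cornerEdges_le fun x hx => ?_).trans hlight⟩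
    have h1 := hmin x
    have h2 := hmax x.2
    rw [mem_cornerEdges] at hx h1
    rw [mem_chordCrossings]
    have := hx.1.symm
    simp only [Prod.fst_swap, Prod.snd_swap]
    grind
  · obtain ⟨c, hc, hmin⟩ := Finset.exists_min_image
      (Finset.univ.filter fun v => a < v ∧ v < b) id (by
        obtain ⟨v, hv⟩ := hne
        exact ⟨v, by simpa using hv⟩)
    simp only [Finset.mem_filter, Finset.mem_univ, true_and, id] at hc hmin
    -- Here `c` is the successor of `a`, so an edge passing over it would start at `a`, which has no
    -- inner neighbour.
    refine ⟨c, hc.1, hc.2, ?_⟩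
    rw [Finset.card_eq_zero.2 (Finset.eq_empty_of_forall_notMem fun x hx => ?_)]
    · exact Nat.zero_le _
    rw [mem_cornerEdges] at hx
    have h1 := hmin x.1
    push Not at hN
    have h2 := hN x.2
    grind

/-- If more than `k` edges run over the inner end of a crossing edge of the chord `ab`, then each of
them is crossed at most `k` times. -/
theorem card_chordCrossings_le_of_mem_cornerEdges {k : ℕ} (hG : InterleavingLight G k) {a b : V}
    {h : V × V} (hh : h ∈ chordCrossings G a b) (hY : k < (cornerEdges G a h.1 b).card)
    {x : V × V} (hx : x ∈ cornerEdges G a h.1 b) : (chordCrossings G x.1 x.2).card ≤ k := by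
  obtain ⟨p, r⟩ := h
  rw [mem_chordCrossings] at hh
  simp only at hh hY hx
  obtain ⟨hadj, hap, hpb, hr | hr⟩ := hh
  · have hheavy : (cornerEdges G a p b).card ≤ (chordCrossings G r p).card := by
      refine Finset.card_le_card fun y hy => ?_
      rw [mem_cornerEdges] at hy
      rw [mem_chordCrossings]
      grind
    rw [mem_cornerEdges] at hx
    exact (hG r p x.1 x.2 hadj.symm hx.1 (hr.trans_le hx.2.1) hx.2.2.1 hx.2.2.2.1).resolve_left
      (by omega)
  · have hheavy : (cornerEdges G a p b).card ≤ (chordCrossings G p r).card := by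
      refine card_cornerEdges_le fun y hy => ?_
      rw [mem_cornerEdges] at hy
      rw [mem_chordCrossings]
      have := hy.1.symm
      simp only [Prod.fst_swap, Prod.snd_swap]
      grind
    rw [mem_cornerEdges] at hx
    exact (hG x.1 x.2 p r hx.1 hadj hx.2.2.1 hx.2.2.2.1 (hx.2.2.2.2.1.trans_lt hr)).resolve_right
      (by omega)

/-- A chord that is crossed at most `2k` times is a side of a triangle that at most `3k` edges pass
and whose other two sides are crossed at most `2k` times. -/
theorem exists_corner {k : ℕ} (hG : InterleavingLight G k) {a b : V}
    (hne : ∃ v, a < v ∧ v < b) (hX : (chordCrossings G a b).card ≤ 2 * k) :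
    ∃ c, a < c ∧ c < b ∧ (cornerEdges G a c b).card ≤ k ∧
      (chordCrossings G a c).card ≤ 2 * k ∧ (chordCrossings G c b).card ≤ 2 * k := by
  classical
  obtain hX0 | hX0 := (chordCrossings G a b).eq_empty_or_nonempty
  · obtain ⟨c, hac, hcb, hY⟩ := exists_card_cornerEdges_le hG hne
    have h1 := card_chordCrossings_left_le (G := G) (a := a) hcb
    have h2 := card_chordCrossings_right_le (G := G) (b := b) hac
    simp only [hX0, Finset.filter_empty, Finset.card_empty] at h1 h2
    exact ⟨c, hac, hcb, hY, by omega, by omega⟩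
  obtain ⟨⟨p, r⟩, hh, hlt, hgt⟩ := Finset.exists_median _ hX0 Prod.fst
  have hh' := mem_chordCrossings.1 hh
  simp only at hlt hgt hh'
  have left_le : ∀ c, a < c → c ≤ p → (cornerEdges G a c b).card ≤ k →
      (chordCrossings G a c).card ≤ 2 * k := by
    intro c hac hcp hY
    have h1 := card_chordCrossings_left_le (G := G) (a := a) (hcp.trans_lt hh'.2.2.1)
    have h2 : ((chordCrossings G a b).filter fun x => x.1 < c).card ≤
        ((chordCrossings G a b).filter fun x => x.1 < p).card :=
      Finset.card_le_card (Finset.monotone_filter_right _ fun x _ hx => hx.trans_le hcp)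
    omega
  have right_le : ∀ c, p ≤ c → c < b → (cornerEdges G a c b).card ≤ k →
      (chordCrossings G c b).card ≤ 2 * k := by
    intro c hpc hcb hY
    have h1 := card_chordCrossings_right_le (G := G) (b := b) (hh'.2.1.trans_le hpc)
    have h2 : ((chordCrossings G a b).filter fun x => c < x.1).card ≤
        ((chordCrossings G a b).filter fun x => p < x.1).card :=
      Finset.card_le_card (Finset.monotone_filter_right _ fun x _ hx => hpc.trans_lt hx)
    omega
  by_cases hY : (cornerEdges G a p b).card ≤ k
  · exact ⟨p, hh'.2.1, hh'.2.2.1, hY, left_le p hh'.2.1 le_rfl hY, right_le p le_rfl hh'.2.2.1 hY⟩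
  push Not at hY
  have hlight : ∀ x ∈ cornerEdges G a p b, (chordCrossings G x.1 x.2).card ≤ k := fun x hx =>
    card_chordCrossings_le_of_mem_cornerEdges hG hh hY hx
  by_cases hA : ∃ v, (a, v) ∈ cornerEdges G a p b
  · obtain ⟨d, hd, hmax⟩ := Finset.exists_max_image
      (Finset.univ.filter fun v => (a, v) ∈ cornerEdges G a p b) id (by
        obtain ⟨v, hv⟩ := hA
        exact ⟨v, by simpa using hv⟩)
    simp only [Finset.mem_filter, Finset.mem_univ, true_and, id] at hd hmax
    have hdk := hlight _ hd
    simp only [mem_cornerEdges] at hd hmax hdk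
    -- As `d` is the farthest such end, no counted edge over `d` starts at `a`; hence all of them
    -- cross the light edge `ad`.
    have hYd : (cornerEdges G a d b).card ≤ k := by
      refine (Finset.card_le_card fun x hx => ?_).trans hdk
      rw [mem_cornerEdges] at hx
      rw [mem_chordCrossings]
      have := hmax x.2
      grind
    have hdb : d < b := by grind
    exact ⟨d, by grind, hdb, hYd, by omega, right_le d hd.2.2.2.1.le hdb hYd⟩
  · obtain ⟨⟨c, q⟩, hcq, hmin⟩ := Finset.exists_min_image (cornerEdges G a p b) Prod.fst
      (Finset.card_pos.1 (by omega))
    have hck := hlight _ hcq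
    have hca : c ≠ a := by
      rintro rfl
      exact hA ⟨q, hcq⟩
    simp only [mem_cornerEdges] at hcq hmin hck
    have hac : a < c := lt_of_le_of_ne hcq.2.1 hca.symm
    have hYq : ∀ x ∈ cornerEdges G a c b, x.2 < q := by
      intro x hx
      rw [mem_cornerEdges] at hx
      have := hmin x
      grind
    have hYc : (cornerEdges G a c b).card ≤ k := by
      refine (card_cornerEdges_le fun x hx => ?_).trans hck
      have h1 := hYq x hx
      rw [mem_cornerEdges] at hx
      rw [mem_chordCrossings]
      have := hx.1.symm
      simp only [Prod.fst_swap, Prod.snd_swap]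
      grind
    refine ⟨c, hac, hcq.2.2.1.trans hh'.2.2.1, hYc, left_le c hac hcq.2.2.1.le hYc, ?_⟩
    -- An edge crossing `cb` but not `cq` has its inner end at or beyond `q > p`, and by `hYq` it
    -- leaves `[a, b]`. This gives `k` from the light edge `cq` and `k` from the median.
    have hsub : chordCrossings G c b ⊆
        chordCrossings G c q ∪ (chordCrossings G a b).filter fun x => p < x.1 := by
      intro x hx
      have h1 := hYq x.swap
      simp only [Finset.mem_union, Finset.mem_filter, mem_chordCrossings, mem_cornerEdges,
        Prod.fst_swap, Prod.snd_swap] at hx h1 ⊢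
      have := hx.1.symm
      grind
    have := (Finset.card_le_card hsub).trans (Finset.card_union_le _ _)
    omega

end Combinatorics

/-! ### Tree decompositions grown leaf by leaf -/

/-- A list of bags is tree-like if it grows from a single bag by putting new bags in front, where
the vertices that a new bag shares with the old ones all lie in one old bag, its parent. -/
inductive TreeBags {V : Type*} : List (Finset V) → Prop
  | single (B : Finset V) : TreeBags [B]
  | leaf {l : List (Finset V)} {P B : Finset V} (hl : TreeBags l) (hP : P ∈ l)
      (hB : ∀ v ∈ B, ∀ C ∈ l, v ∈ C → v ∈ P) : TreeBags (B :: l)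

/-- The tree that arises from `T` by adding a leaf `none` at the node `p`. -/
def withLeaf {ι : Type*} (T : SimpleGraph ι) (p : ι) : SimpleGraph (Option ι) :=
  T.map Function.Embedding.some ⊔ SimpleGraph.edge none (some p)

section AddLeaf

variable {ι : Type*} {T : SimpleGraph ι} {p : ι}

theorem withLeaf_adj_some {i j : ι} (h : T.Adj i j) : (withLeaf T p).Adj (some i) (some j) :=
  Or.inl ((SimpleGraph.map_adj_apply (f := Function.Embedding.some)).2 h)

theorem withLeaf_adj_none : (withLeaf T p).Adj none (some p) :=
  Or.inr (by simp [SimpleGraph.edge_adj])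

theorem isTree_withLeaf [Finite ι] (hT : T.IsTree) : (withLeaf T p).IsTree := by
  have hsome : ∀ i, (withLeaf T p).Reachable (some p) (some i) := fun i =>
    (hT.connected p i).map (⟨some, withLeaf_adj_some⟩ : T →g withLeaf T p)
  refine SimpleGraph.isTree_iff_connected_and_card.2
    ⟨SimpleGraph.connected_iff_exists_forall_reachable _ |>.2 ⟨some p, ?_⟩, ?_⟩
  · rintro (_ | i)
    · exact withLeaf_adj_none.symm.reachable
    · exact hsome i
  · have hedge : (withLeaf T p).edgeSet = Sym2.map some '' T.edgeSet ∪ {s(none, some p)} := by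
      rw [withLeaf, SimpleGraph.edgeSet_sup, SimpleGraph.edgeSet_map]
      congr 1
      ext e
      rw [SimpleGraph.edgeSet_edge]
      grind [Sym2.mem_diagSet, Sym2.mk_isDiag_iff]
    have hnot : s(none, some p) ∉ Sym2.map some '' T.edgeSet := by
      rintro ⟨e, -, he⟩
      have : none ∈ Sym2.map some e := he ▸ Sym2.mem_mk_left _ _
      simp at this
    rw [Nat.card_coe_set_eq, hedge, Set.union_singleton, Set.ncard_insert_of_notMem hnot,
      Set.ncard_image_of_injective _ (Sym2.map.injective (Option.some_injective ι)),
      ← Nat.card_coe_set_eq, (SimpleGraph.isTree_iff_connected_and_card.1 hT).2, Finite.card_option]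

/-- A new leaf keeps a node set connected if the set also contains the leaf's neighbour, or has no
old node at all. -/
theorem preconnected_induce_withLeaf {S : Set (Option ι)}
    (hS : (T.induce {i | some i ∈ S}).Preconnected)
    (hp : none ∈ S → (∃ i, some i ∈ S) → some p ∈ S) :
    ((withLeaf T p).induce S).Preconnected := by
  have hsome : ∀ i j (hi : some i ∈ S) (hj : some j ∈ S),
      ((withLeaf T p).induce S).Reachable ⟨some i, hi⟩ ⟨some j, hj⟩ := fun i j hi hj =>
    (hS ⟨i, hi⟩ ⟨j, hj⟩).map
      (⟨fun x => ⟨some x.1, x.2⟩, fun h => withLeaf_adj_some h⟩ :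
        T.induce {i | some i ∈ S} →g (withLeaf T p).induce S)
  have hnone : ∀ j (hn : none ∈ S) (hj : some j ∈ S),
      ((withLeaf T p).induce S).Reachable ⟨none, hn⟩ ⟨some j, hj⟩ := fun j hn hj => by
    have hpS := hp hn ⟨j, hj⟩
    have hadj : ((withLeaf T p).induce S).Adj ⟨none, hn⟩ ⟨some p, hpS⟩ := withLeaf_adj_none
    exact hadj.reachable.trans (hsome p j hpS hj)
  rintro ⟨_ | i, hi⟩ ⟨_ | j, hj⟩
  · rfl
  · exact hnone j hi hj
  · exact (hnone i hj hi).symm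
  · exact hsome i j hi hj

end AddLeaf

theorem TreeBags.exists_tree {V : Type*} {l : List (Finset V)} (hl : TreeBags l) :
    ∃ (ι : Type) (_ : Fintype ι) (T : SimpleGraph ι) (bag : ι → Finset V), T.IsTree ∧
      (∀ B, B ∈ l ↔ ∃ i, bag i = B) ∧ ∀ v, (T.induce {i | v ∈ bag i}).Preconnected := by
  induction hl with
  | single B =>
    refine ⟨Unit, inferInstance, ⊥, fun _ => B, SimpleGraph.IsTree.of_subsingleton, ?_, ?_⟩
    · simp [eq_comm]
    · exact fun v x y => by rw [Subsingleton.elim x y]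
  | @leaf l P B hl hP hB ih =>
    obtain ⟨ι, _, T, bag, hT, hbag, hconn⟩ := ih
    obtain ⟨p, hp⟩ := (hbag P).1 hP
    refine ⟨Option ι, inferInstance, withLeaf T p, fun o => o.elim B bag, isTree_withLeaf hT,
      fun C => ?_, fun v => preconnected_induce_withLeaf (hconn v) ?_⟩
    · simp [hbag, Option.exists, eq_comm]
    · rintro hn ⟨i, hi⟩
      change v ∈ bag p
      rw [hp]
      exact hB v hn (bag i) ((hbag _).2 ⟨i, rfl⟩) hi

theorem treeWidth_le_of_treeBags {V : Type*} (G : SimpleGraph V) {l : List (Finset V)} {w : ℕ}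
    (hl : TreeBags l) (hw : ∀ B ∈ l, B.card ≤ w + 1) (hV : ∀ v, ∃ B ∈ l, v ∈ B)
    (hE : ∀ u v, G.Adj u v → ∃ B ∈ l, u ∈ B ∧ v ∈ B) : treeWidth G ≤ w := by
  obtain ⟨ι, _, T, bag, hT, hbag, hconn⟩ := hl.exists_tree
  let φ := Fintype.equivFin ι
  let Φ : T ≃g T.map φ.toEmbedding := SimpleGraph.Iso.map φ T
  have hstrong : ∀ u v, G.Adj u v → ∃ i, u ∈ bag (φ.symm i) ∧ v ∈ bag (φ.symm i) := by
    intro u v h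
    obtain ⟨B, hB, hu, hv⟩ := hE u v h
    obtain ⟨i, rfl⟩ := (hbag B).1 hB
    exact ⟨φ i, by simpa using hu, by simpa using hv⟩
  let X : GraphDecomposition G (T.map φ.toEmbedding) :=
    { bag := fun i => bag (φ.symm i)
      connected := fun v => by
        obtain ⟨B, hB, hv⟩ := hV v
        obtain ⟨i, rfl⟩ := (hbag B).1 hB
        have : Nonempty {i | v ∈ bag i} := ⟨⟨i, hv⟩⟩
        refine SimpleGraph.Connected.map (G := T.induce {i | v ∈ bag i})
          ⟨fun x => ⟨φ x.1, by simpa using show v ∈ bag x.1 from x.2⟩, fun h => Φ.map_adj_iff.2 h⟩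
          ?_ ⟨hconn v⟩
        rintro ⟨j, hj⟩
        exact ⟨⟨φ.symm j, hj⟩, Subtype.ext (φ.apply_symm_apply j)⟩
      touch := fun u v h => by
        obtain ⟨i, hu, hv⟩ := hstrong u v h
        exact ⟨i, i, hu, hv, Or.inl rfl⟩ }
  have hX : X.width ≤ w + 1 := Finset.sup_le fun i _ => hw _ ((hbag _).2 ⟨φ.symm i, rfl⟩)
  have hmem : X.width ∈ strongTreeWidths G := ⟨_, _, X, Φ.isTree_iff.1 hT, hstrong, rfl⟩
  have := (Nat.sInf_le hmem).trans hX
  unfold treeWidth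
  omega

/-! ### The tree decomposition along the triangulation -/

section Sweep

variable {V : Type*} [LinearOrder V] [Fintype V] {G : SimpleGraph V}

/-- The bag of the triangle `acb`: its corners and the lower ends of the edges that pass it. -/
noncomputable def triangleBag (G : SimpleGraph V) (a c b : V) : Finset V :=
  {a, c, b} ∪ ((chordCrossings G a b).image fun x => min x.1 x.2) ∪
    (cornerEdges G a c b).image Prod.fst

theorem mem_triangleBag {a c b v : V} : v ∈ triangleBag G a c b ↔ v = a ∨ v = c ∨ v = b ∨
    (∃ x ∈ chordCrossings G a b, min x.1 x.2 = v) ∨ ∃ x ∈ cornerEdges G a c b, x.1 = v := by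
  simp only [triangleBag, Finset.mem_union, Finset.mem_insert, Finset.mem_singleton,
    Finset.mem_image, or_assoc]

theorem card_triangleBag_le {k : ℕ} {a c b : V} (hX : (chordCrossings G a b).card ≤ 2 * k)
    (hY : (cornerEdges G a c b).card ≤ k) : (triangleBag G a c b).card ≤ 3 * k + 2 + 1 := by
  have h1 := Finset.card_union_le
    ({a, c, b} ∪ ((chordCrossings G a b).image fun x => min x.1 x.2))
    ((cornerEdges G a c b).image Prod.fst)
  have h2 := Finset.card_union_le {a, c, b} ((chordCrossings G a b).image fun x => min x.1 x.2)
  have h3 := Finset.card_le_three (a := a) (b := c) (c := b)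
  have h4 := Finset.card_image_le (s := chordCrossings G a b) (f := fun x => min x.1 x.2)
  have h5 := Finset.card_image_le (s := cornerEdges G a c b) (f := Prod.fst)
  unfold triangleBag
  omega

/-- A partial tree decomposition with a bag that contains `a`, `b` and the lower end of each edge
crossing the chord `ab`, and in which the latter are the only vertices between `a` and `b`,
extends to one that covers the vertices and edges on that side of the chord. -/
theorem exists_treeBags_extend {k : ℕ} (hG : InterleavingLight G k) (n : ℕ) :
    ∀ (a b : V) (l : List (Finset V)) (P : Finset V), a < b →
      (Finset.univ.filter fun v => a < v ∧ v < b).card ≤ n →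
      (chordCrossings G a b).card ≤ 2 * k → TreeBags l → (∀ B ∈ l, B.card ≤ 3 * k + 2 + 1) →
      P ∈ l → a ∈ P → b ∈ P → (∀ x ∈ chordCrossings G a b, min x.1 x.2 ∈ P) →
      (∀ B ∈ l, ∀ v ∈ B, a < v → v < b → ∃ x ∈ chordCrossings G a b, min x.1 x.2 = v) →
      ∃ l' : List (Finset V), TreeBags l' ∧ (∀ B ∈ l', B.card ≤ 3 * k + 2 + 1) ∧ l ⊆ l' ∧
        (∀ B ∈ l', ∀ v ∈ B, (∃ C ∈ l, v ∈ C) ∨ a < v ∧ v < b) ∧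
        (∀ v, a < v → v < b → ∃ B ∈ l', v ∈ B) ∧
        (∀ u v, G.Adj u v → a ≤ u → u < v → v ≤ b → ∃ B ∈ l', u ∈ B ∧ v ∈ B) ∧
        ∀ x ∈ chordCrossings G a b, x.2 < x.1 → ∃ B ∈ l', x.1 ∈ B ∧ x.2 ∈ B := by
  induction n with
  | zero =>
    intro a b l P hab hcard hX hl hw hP haP hbP hXP hold
    have hempty : ∀ v, a < v → v < b → False := fun v h1 h2 => by
      have := Finset.card_eq_zero.1 (Nat.le_zero.1 hcard)
      exact Finset.notMem_empty v (this ▸ by simp [h1, h2])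
    refine ⟨l, hl, hw, fun _ h => h, fun B hB v hv => Or.inl ⟨B, hB, hv⟩,
      fun v h1 h2 => (hempty v h1 h2).elim, fun u v _ hu huv hv => ⟨P, hP, ?_⟩, fun x hx => ?_⟩
    · have h1 := hempty u
      have h2 := hempty v
      grind
    · rw [mem_chordCrossings] at hx
      exact (hempty x.1 hx.2.1 hx.2.2.1).elim
  | succ n ih =>
    intro a b l P hab hcard hX hl hw hP haP hbP hXP hold
    by_cases hne : ∃ v, a < v ∧ v < b
    swap
    · exact ih a b l P hab (by
        rw [Finset.filter_false_of_mem fun v _ h => hne ⟨v, h⟩]; simp) hX hl hw hP haP hbP hXP hold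
    obtain ⟨c, hac, hcb, hY, hXl, hXr⟩ := exists_corner hG hne hX
    have hcardl : (Finset.univ.filter fun v => a < v ∧ v < c).card ≤ n := by
      refine Nat.le_of_lt_succ ((Finset.card_lt_card ?_).trans_le hcard)
      refine (Finset.ssubset_iff_of_subset fun v hv => ?_).2 ⟨c, by simp [hac, hcb], by simp⟩
      simp only [Finset.mem_filter, Finset.mem_univ, true_and] at hv ⊢
      exact ⟨hv.1, hv.2.trans hcb⟩
    have hcardr : (Finset.univ.filter fun v => c < v ∧ v < b).card ≤ n := by
      refine Nat.le_of_lt_succ ((Finset.card_lt_card ?_).trans_le hcard)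
      refine (Finset.ssubset_iff_of_subset fun v hv => ?_).2 ⟨c, by simp [hac, hcb], by simp⟩
      simp only [Finset.mem_filter, Finset.mem_univ, true_and] at hv ⊢
      exact ⟨hac.trans hv.1, hv.2⟩
    set B := triangleBag G a c b with hBdef
    have hXB : ∀ x ∈ chordCrossings G a b, min x.1 x.2 ∈ B := fun x hx =>
      mem_triangleBag.2 (Or.inr (Or.inr (Or.inr (Or.inl ⟨x, hx, rfl⟩))))
    have hYB : ∀ x ∈ cornerEdges G a c b, x.1 ∈ B := fun x hx =>
      mem_triangleBag.2 (Or.inr (Or.inr (Or.inr (Or.inr ⟨x, hx, rfl⟩))))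
    have haB : a ∈ B := mem_triangleBag.2 (by simp)
    have hcB : c ∈ B := mem_triangleBag.2 (by simp)
    have hbB : b ∈ B := mem_triangleBag.2 (by simp)
    -- Old vertices strictly between `a` and `b` are lower ends of edges crossing `ab`, and the
    -- remaining vertices of `B` outside that interval are `a`, `b` or such lower ends; all lie in
    -- `P`.
    have hBl : TreeBags (B :: l) := by
      refine hl.leaf hP fun v hv C hC hvC => ?_
      by_cases hv' : a < v ∧ v < b
      · obtain ⟨x, hx, rfl⟩ := hold C hC v hvC hv'.1 hv'.2
        exact hXP x hx
      · rw [hBdef, mem_triangleBag] at hv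
        rcases hv with rfl | rfl | rfl | ⟨x, hx, rfl⟩ | ⟨x, hx, rfl⟩
        · exact haP
        · exact (hv' ⟨hac, hcb⟩).elim
        · exact hbP
        · exact hXP x hx
        · rw [mem_cornerEdges] at hx
          grind
    have hXBl : ∀ x ∈ chordCrossings G a c, min x.1 x.2 ∈ B := by
      intro x hx
      have h1 := hXB x
      have h2 := hYB x
      rw [mem_chordCrossings] at hx h1
      rw [mem_cornerEdges] at h2
      grind
    have hXBr : ∀ x ∈ chordCrossings G c b, min x.1 x.2 ∈ B := by
      intro x hx
      have h1 := hXB x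
      have h2 := hYB x.swap
      rw [mem_chordCrossings] at hx h1
      rw [mem_cornerEdges] at h2
      have := hx.1.symm
      simp only [Prod.fst_swap, Prod.snd_swap] at h2
      grind
    have hBold : ∀ C ∈ B :: l, ∀ v ∈ C, a < v → v < b →
        v = c ∨ (∃ x ∈ chordCrossings G a b, min x.1 x.2 = v) ∨
          ∃ x ∈ cornerEdges G a c b, x.1 = v := by
      intro C hC v hv hav hvb
      rcases List.mem_cons.1 hC with rfl | hC
      · rw [hBdef, mem_triangleBag] at hv
        rcases hv with rfl | rfl | rfl | h | h
        · exact (lt_irrefl _ hav).elim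
        · exact Or.inl rfl
        · exact (lt_irrefl _ hvb).elim
        · exact Or.inr (Or.inl h)
        · exact Or.inr (Or.inr h)
      · exact Or.inr (Or.inl (hold C hC v hv hav hvb))
    obtain ⟨l₁, hl₁, hw₁, hsub₁, hnew₁, hver₁, hedge₁, hcross₁⟩ :=
      ih a c (B :: l) B hac hcardl hXl hBl
        (List.forall_mem_cons.2 ⟨card_triangleBag_le hX hY, hw⟩) List.mem_cons_self haB hcB hXBl (by
          intro C hC v hv hav hvc
          rcases hBold C hC v hv hav (hvc.trans hcb) with rfl | ⟨x, hx, h⟩ | ⟨x, hx, h⟩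
          · exact (lt_irrefl _ hvc).elim
          · refine ⟨x, ?_, h⟩
            rw [mem_chordCrossings] at hx ⊢
            grind
          · refine ⟨x, ?_, ?_⟩
            · rw [mem_cornerEdges] at hx
              rw [mem_chordCrossings]
              grind
            · rw [mem_cornerEdges] at hx
              rw [← h]
              exact min_eq_left (hx.2.2.1.trans hx.2.2.2.1).le)
    -- The right side is grown onto `l₁`, again from `B`. By `hnew₁` the left bags add only vertices
    -- before `c`, so they do not disturb the condition on `(c, b)`.
    obtain ⟨l₂, hl₂, hw₂, hsub₂, hnew₂, hver₂, hedge₂, hcross₂⟩ :=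
      ih c b l₁ B hcb hcardr hXr hl₁ hw₁ (hsub₁ List.mem_cons_self) hcB hbB hXBr (by
          intro C hC v hv hcv hvb
          rcases hnew₁ C hC v hv with ⟨C', hC', hv'⟩ | h
          swap
          · exact (h.2.not_gt hcv).elim
          rcases hBold C' hC' v hv' (hac.trans hcv) hvb with rfl | ⟨x, hx, h⟩ | ⟨x, hx, h⟩
          · exact (lt_irrefl _ hcv).elim
          · refine ⟨x, ?_, h⟩
            rw [mem_chordCrossings] at hx ⊢
            grind
          · rw [mem_cornerEdges] at hx
            grind)
    have hB₂ : B ∈ l₂ := hsub₂ (hsub₁ List.mem_cons_self)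
    refine ⟨l₂, hl₂, hw₂, fun C hC => hsub₂ (hsub₁ (List.mem_cons_of_mem _ hC)), ?_, ?_, ?_, ?_⟩
    · intro C hC v hv
      rcases hnew₂ C hC v hv with ⟨C', hC', hv'⟩ | h
      · rcases hnew₁ C' hC' v hv' with ⟨C'', hC'', hv''⟩ | h
        · rcases List.mem_cons.1 hC'' with rfl | hC''
          · by_cases hv3 : a < v ∧ v < b
            · exact Or.inr hv3
            · left
              rw [hBdef, mem_triangleBag] at hv''
              rcases hv'' with rfl | rfl | rfl | ⟨x, hx, rfl⟩ | ⟨x, hx, rfl⟩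
              · exact ⟨P, hP, haP⟩
              · exact (hv3 ⟨hac, hcb⟩).elim
              · exact ⟨P, hP, hbP⟩
              · exact ⟨P, hP, hXP x hx⟩
              · rw [mem_cornerEdges] at hx
                have : x.1 = a := by grind
                exact ⟨P, hP, this ▸ haP⟩
          · exact Or.inl ⟨C'', hC'', hv''⟩
        · exact Or.inr ⟨h.1, h.2.trans hcb⟩
      · exact Or.inr ⟨hac.trans h.1, h.2⟩
    · intro v hav hvb
      rcases lt_trichotomy v c with h | rfl | h
      · obtain ⟨C, hC, hv⟩ := hver₁ v hav h
        exact ⟨C, hsub₂ hC, hv⟩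
      · exact ⟨B, hB₂, hcB⟩
      · exact hver₂ v h hvb
    · intro u v huv hau hlt hvb
      rcases le_or_gt v c with hvc | hcv
      · obtain ⟨C, hC, h⟩ := hedge₁ u v huv hau hlt hvc
        exact ⟨C, hsub₂ hC, h⟩
      rcases le_or_gt c u with hcu | huc
      · exact hedge₂ u v huv hcu hlt hvb
      rcases eq_or_lt_of_le hvb with rfl | hvb
      · refine ⟨B, hB₂, ?_, hbB⟩
        by_cases hua : u = a
        · exact hua ▸ haB
        · exact hYB (u, v) (mem_cornerEdges.2 ⟨huv, hau, huc, hcv, le_rfl, fun h => hua h.1⟩)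
      -- An edge over the apex is covered on the right, where its inner end is the upper one. This
      -- is why the crossing edges to be covered are only those with `x.2 < x.1`.
      · obtain ⟨C, hC, h1, h2⟩ :=
          hcross₂ (v, u) (mem_chordCrossings.2 ⟨huv.symm, hcv, hvb, Or.inl huc⟩) hlt
        exact ⟨C, hC, h2, h1⟩
    · intro x hx hlt
      have hmin := hXB x hx
      rw [min_eq_right hlt.le] at hmin
      rw [mem_chordCrossings] at hx
      rcases lt_trichotomy x.1 c with h | h | h
      · obtain ⟨C, hC, h⟩ := hcross₁ x (by rw [mem_chordCrossings]; grind) hlt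
        exact ⟨C, hsub₂ hC, h⟩
      · exact ⟨B, hB₂, h ▸ hcB, hmin⟩
      · exact hcross₂ x (by rw [mem_chordCrossings]; grind) hlt

theorem treeWidth_le_of_interleavingLight {k : ℕ} (hG : InterleavingLight G k) :
    treeWidth G ≤ ((3 * k + 2 : ℕ) : ℤ) := by
  rcases subsingleton_or_nontrivial V with hV | hV
  · refine treeWidth_le_of_treeBags G (TreeBags.single Finset.univ) ?_ ?_ ?_
    · intro B hB
      have := Finset.card_le_one_of_subsingleton B
      omega
    · simp
    · simp
  · obtain ⟨a, ha⟩ := Finite.exists_min (id : V → V)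
    obtain ⟨b, hb⟩ := Finite.exists_max (id : V → V)
    simp only [id] at ha hb
    have hab : a < b := by
      obtain ⟨x, y, hxy⟩ := exists_pair_ne V
      refine lt_of_le_of_ne (ha b) ?_
      rintro rfl
      exact hxy (le_antisymm ((hb x).trans (ha y)) ((hb y).trans (ha x)))
    have hX : chordCrossings G a b = ∅ := Finset.eq_empty_of_forall_notMem fun x hx => by
      rw [mem_chordCrossings] at hx
      rcases hx.2.2.2 with h | h
      · exact (ha _).not_gt h
      · exact (hb _).not_gt h
    -- The chord from the least to the greatest vertex has nothing beyond it, so no edge crosses it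
    -- and the root bag is just `{a, b}`.
    obtain ⟨l, hl, hw, hsub, -, hver, hedge, -⟩ := exists_treeBags_extend hG _ a b [{a, b}] {a, b}
      hab le_rfl (by simp [hX]) (TreeBags.single _) (by
        simpa using Finset.card_le_two.trans (by omega)) (by simp) (by simp) (by simp)
      (by simp [hX]) (by
        intro B hB v hv h1 h2
        rw [List.mem_singleton.1 hB] at hv
        rcases Finset.mem_insert.1 hv with rfl | hv
        · exact (lt_irrefl _ h1).elim
        · exact (h2.ne (Finset.mem_singleton.1 hv)).elim)
    have hroot := hsub (List.mem_singleton_self _)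
    refine treeWidth_le_of_treeBags G hl hw (fun v => ?_) (fun u v huv => ?_)
    · rcases eq_or_lt_of_le (ha v) with rfl | h1
      · exact ⟨_, hroot, by simp⟩
      rcases eq_or_lt_of_le (hb v) with rfl | h2
      · exact ⟨_, hroot, by simp⟩
      exact hver v h1 h2
    · rcases lt_or_gt_of_ne huv.ne with h | h
      · exact hedge u v huv (ha u) h (hb v)
      · obtain ⟨B, hB, h1, h2⟩ := hedge v u huv.symm (ha v) h (hb u)
        exact ⟨B, hB, h2, h1⟩

end Sweep

/-! ### Interleaving chords of a circle meet -/

section Geometry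

/-- Twice the signed area of a triangle in the plane. -/
def signedArea (p q r : Plane) : ℝ :=
  (q 0 - p 0) * (r 1 - p 1) - (q 1 - p 1) * (r 0 - p 0)

/-- The diagonals of a quadrilateral whose vertices are in convex position meet. -/
theorem segment_inter_segment_nonempty {p q r s : Plane} (h₁ : 0 < signedArea q r s)
    (h₂ : 0 < signedArea p r s) (h₃ : 0 < signedArea p q s) (h₄ : 0 < signedArea p q r) :
    (segment ℝ p r ∩ segment ℝ q s).Nonempty := by
  have hsum : signedArea q r s + signedArea p q s = signedArea p r s + signedArea p q r := by
    unfold signedArea; ring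
  set t := signedArea q r s + signedArea p q s with ht
  have ht0 : 0 < t := by positivity
  -- The intersection point divides each diagonal in the ratio of the areas cut off by the other
  -- one.
  refine ⟨(signedArea q r s / t) • p + (signedArea p q s / t) • r,
    ⟨_, _, by positivity, by positivity, by field_simp; exact ht.symm, rfl⟩,
    ⟨signedArea p r s / t, signedArea p q r / t, by positivity, by positivity,
      by field_simp; exact hsum.symm, ?_⟩⟩
  ext i
  simp only [PiLp.add_apply, PiLp.smul_apply, smul_eq_mul]
  field_simp
  unfold signedArea
  fin_cases i <;> simp <;> ring

/-- In half-angles the area factors into three sines of half-differences, each in `(0, π)`. -/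
theorem signedArea_pos_of_arg_lt {o p q r : Plane} {R α β γ : ℝ} (hR : 0 < R)
    (hp : p 0 = o 0 + R * Real.cos α ∧ p 1 = o 1 + R * Real.sin α)
    (hq : q 0 = o 0 + R * Real.cos β ∧ q 1 = o 1 + R * Real.sin β)
    (hr : r 0 = o 0 + R * Real.cos γ ∧ r 1 = o 1 + R * Real.sin γ)
    (hα : -Real.pi < α) (hαβ : α < β) (hβγ : β < γ) (hγ : γ ≤ Real.pi) :
    0 < signedArea p q r := by
  have half : ∀ θ : ℝ, Real.cos θ = Real.cos (θ / 2) ^ 2 - Real.sin (θ / 2) ^ 2 ∧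
      Real.sin θ = 2 * Real.sin (θ / 2) * Real.cos (θ / 2) := fun θ => by
    rw [← Real.cos_two_mul', ← Real.sin_two_mul]
    constructor <;> congr 1 <;> ring
  have key : signedArea p q r = 4 * R ^ 2 * (Real.sin (β / 2 - α / 2) * Real.sin (γ / 2 - β / 2) *
      Real.sin (γ / 2 - α / 2)) := by
    unfold signedArea
    rw [hp.1, hp.2, hq.1, hq.2, hr.1, hr.2, (half α).1, (half α).2, (half β).1, (half β).2,
      (half γ).1, (half γ).2, Real.sin_sub, Real.sin_sub, Real.sin_sub]
    have h1 := Real.sin_sq_add_cos_sq (α / 2)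
    have h2 := Real.sin_sq_add_cos_sq (β / 2)
    have h3 := Real.sin_sq_add_cos_sq (γ / 2)
    generalize Real.sin (α / 2) = s₁, Real.cos (α / 2) = c₁, Real.sin (β / 2) = s₂,
      Real.cos (β / 2) = c₂, Real.sin (γ / 2) = s₃, Real.cos (γ / 2) = c₃ at *
    linear_combination R ^ 2 * (
      (2 * s₂ * c₂ * (c₃ ^ 2 - s₃ ^ 2) - 2 * s₃ * c₃ * (c₂ ^ 2 - s₂ ^ 2)) * h1
      + (2 * s₃ * c₃ * (c₁ ^ 2 - s₁ ^ 2) - 2 * s₁ * c₁ * (c₃ ^ 2 - s₃ ^ 2)) * h2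
      + (2 * s₁ * c₁ * (c₂ ^ 2 - s₂ ^ 2) - 2 * s₂ * c₂ * (c₁ ^ 2 - s₁ ^ 2)) * h3)
  rw [key]
  have h1 : 0 < Real.sin (β / 2 - α / 2) :=
    Real.sin_pos_of_pos_of_lt_pi (by linarith) (by linarith)
  have h2 : 0 < Real.sin (γ / 2 - β / 2) :=
    Real.sin_pos_of_pos_of_lt_pi (by linarith) (by linarith)
  have h3 : 0 < Real.sin (γ / 2 - α / 2) :=
    Real.sin_pos_of_pos_of_lt_pi (by linarith) (by linarith)
  positivity

/-- Points on a circle can be numbered so that interleaving chords meet. -/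
theorem exists_linearOrder_of_cospherical {V : Type*} {pos : V → Plane}
    (hinj : Function.Injective pos) (hpos : EuclideanGeometry.Cospherical (Set.range pos)) :
    ∃ _ : LinearOrder V, ∀ a b c d : V, a < b → b < c → c < d →
      (segment ℝ (pos a) (pos c) ∩ segment ℝ (pos b) (pos d)).Nonempty := by
  obtain ⟨o, R, hR⟩ := hpos
  let z : V → ℂ := fun v => ⟨pos v 0 - o 0, pos v 1 - o 1⟩
  have hz : ∀ v, ‖z v‖ = R := fun v => by
    rw [← hR (pos v) ⟨v, rfl⟩, EuclideanSpace.dist_eq, Complex.norm_eq_sqrt_sq_add_sq,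
      Fin.sum_univ_two, Real.dist_eq, Real.dist_eq, sq_abs, sq_abs]
  have hcoord : ∀ v, pos v 0 = o 0 + R * Real.cos (z v).arg ∧
      pos v 1 = o 1 + R * Real.sin (z v).arg := fun v => by
    have h1 := Complex.norm_mul_cos_arg (z v)
    have h2 := Complex.norm_mul_sin_arg (z v)
    rw [hz] at h1 h2
    rw [h1, h2]
    simp [z]
  have harg : Function.Injective fun v => (z v).arg := fun u v huv => by
    apply hinj
    simp only at huv
    ext i
    fin_cases i
    · exact (hcoord u).1.trans (huv ▸ (hcoord v).1.symm)
    · exact (hcoord u).2.trans (huv ▸ (hcoord v).2.symm)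
  -- The vertices are ordered by their angle around the centre, cut open at `π`.
  refine ⟨LinearOrder.lift' _ harg, fun a b c d hab hbc hcd => ?_⟩
  replace hab : (z a).arg < (z b).arg := hab
  replace hbc : (z b).arg < (z c).arg := hbc
  replace hcd : (z c).arg < (z d).arg := hcd
  have hR0 : 0 < R := by
    refine lt_of_le_of_ne (hz a ▸ norm_nonneg _) fun h => hab.ne ?_
    rw [norm_eq_zero.1 ((hz a).trans h.symm), norm_eq_zero.1 ((hz b).trans h.symm)]
  have area : ∀ u v w, (z u).arg < (z v).arg → (z v).arg < (z w).arg →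
      0 < signedArea (pos u) (pos v) (pos w) := fun u v w huv hvw =>
    signedArea_pos_of_arg_lt hR0 (hcoord u) (hcoord v) (hcoord w) (Complex.neg_pi_lt_arg _) huv hvw
      (Complex.arg_le_pi _)
  exact segment_inter_segment_nonempty (area b c d hbc hcd) (area a c d (hab.trans hbc) hcd)
    (area a b d hab (hbc.trans hcd)) (area a b c hab hbc)

end Geometry

/-! ### From the drawing to the combinatorial hypothesis -/

section Drawing

variable {V : Type*} {G : SimpleGraph V} (Γ : RectilinearDrawing G)

theorem RectilinearDrawing.Crosses.symm {Γ : RectilinearDrawing G} {e f : Sym2 V}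
    (h : Γ.Crosses e f) : Γ.Crosses f e := by
  obtain ⟨he, hf, hne, x, hx, hv⟩ := h
  exact ⟨hf, he, hne.symm, x, hx.symm, fun v h1 h2 => hv v h2 h1⟩

theorem RectilinearDrawing.crosses_of_interleave [LinearOrder V]
    (hmeet : ∀ a b c d : V, a < b → b < c → c < d →
      (segment ℝ (Γ.pos a) (Γ.pos c) ∩ segment ℝ (Γ.pos b) (Γ.pos d)).Nonempty)
    {a b c d : V} (hab : a < b) (hbc : b < c) (hcd : c < d) (hac : G.Adj a c) (hbd : G.Adj b d) :
    Γ.Crosses s(a, c) s(b, d) := by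
  have hdisj : ∀ v, v ∈ s(a, c) → v ∈ s(b, d) → False := by
    intro v h1 h2
    rw [Sym2.mem_iff] at h1 h2
    grind
  refine ⟨hac, hbd, fun h => hdisj a (by simp) (h ▸ by simp), ?_⟩
  obtain ⟨x, hx⟩ := hmeet a b c d hab hbc hcd
  exact ⟨x, hx, fun v h1 h2 => (hdisj v h1 h2).elim⟩

theorem RectilinearDrawing.card_chordCrossings_le [LinearOrder V] [Fintype V]
    (hmeet : ∀ a b c d : V, a < b → b < c → c < d →
      (segment ℝ (Γ.pos a) (Γ.pos c) ∩ segment ℝ (Γ.pos b) (Γ.pos d)).Nonempty)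
    {a b : V} (hadj : G.Adj a b) :
    (chordCrossings G a b).card ≤ (Γ.crossedEdges s(a, b)).ncard := by
  rw [← Set.ncard_coe_finset]
  refine Set.ncard_le_ncard_of_injOn (fun x => s(x.1, x.2)) ?_ ?_ (Set.toFinite _)
  · intro x hx
    rw [Finset.mem_coe, mem_chordCrossings] at hx
    obtain ⟨hx, h1, h2, h3 | h3⟩ := hx
    · change Γ.Crosses _ _
      rw [Sym2.eq_swap (a := x.1)]
      exact (Γ.crosses_of_interleave hmeet h3 h1 h2 hx.symm hadj).symm
    · exact Γ.crosses_of_interleave hmeet h1 h2 h3 hadj hx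
  · intro x hx y hy hxy
    rw [Finset.mem_coe, mem_chordCrossings] at hx hy
    rcases Sym2.eq_iff.1 hxy with h | h
    · exact Prod.ext h.1 h.2
    -- The two pairs cannot be swaps of each other, since the first entry lies strictly inside `(a,
    -- b)` and the second outside `[a, b]`.
    · grind

end Drawing

theorem mainTheorem10 {V : Type*} [Finite V] (G : SimpleGraph V) (k : ℕ)
    (Γ : RectilinearDrawing G) (hΓ : Γ.IsConvex)
    (hk : ∀ e f : Sym2 V, Γ.Crosses e f →
      (Γ.crossedEdges e).ncard ≤ k ∨ (Γ.crossedEdges f).ncard ≤ k) :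
    treeWidth G ≤ 3 * (k : ℤ) + 11 := by
  have := Fintype.ofFinite V
  obtain ⟨_, hmeet⟩ := exists_linearOrder_of_cospherical Γ.injective hΓ
  have hG : InterleavingLight G k := fun a b c d hab hcd hac hcb hbd =>
    (hk _ _ (Γ.crosses_of_interleave hmeet hac hcb hbd hab hcd)).imp
      (Γ.card_chordCrossings_le hmeet hab).trans (Γ.card_chordCrossings_le hmeet hcd).trans
  -- This bound is `3k + 2`, stronger than required.
  have := treeWidth_le_of_interleavingLight hG
  push_cast at this
  linarith
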